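/- Let $\mathbb T=\mathbb R/\mathbb Z$ be the circle group with normalized Haar measure $\mu$. For a probability $\nu$ on $\mathbb T$ put $\hat\nu(n)=\int e^{-2\pi i n x}\,d\nu(x)$, $n\in\mathbb Z$, let $\nu^{m}$ denote the $m$-fold convolution power of $\nu$, and let $P_\nu$ be the Markov operator $P_\nu f(x)=\nu*f(x)=\int_{\mathbb T} f(x-y)\,d\nu(y)$, for which $\mu$ is invariant. "Singular" means singular with respect to $\mu$; $\nu$ is Rajchman if $\hat\nu(n)\to0$ as $|n|\to\infty$; $P_\nu$ is Harris recurrent if for some $m\ge1$ the power $P_\nu^m$ dominates a non-zero integral operator, i.e. there is a measurable $k\ge 0$ on $\mathbb T\times\mathbb T$, not $\mu\times\mu$-a.e. zero, such that for every measurable $f\ge 0$, $P_\nu^m f(x)\ge\int k(x,y)f(y)\,d\mu(y)$ for $\mu$-a.e. $x$; and $P_\nu$ is hyperbounded if for some $1<p<q\le\infty$ it maps $L^p(\mathbb T,\mu)$ continuously into $L^q(\mathbb T,\mu)$. There exists a probability $\nu$ on $\mathbb T$ with the following properties. (i) $\nu$ is a Riesz product: there are real numbers $a_k\neq0$ with $|a_k|\le1$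 and positive integers $n_k$ with $\inf_k n_{k+1}/n_k>3$ such that $\nu$ is the weak limit of the measures $\prod_{k=1}^N\bigl(1+a_k\cos(2\pi n_kx)\bigr)\,d\mu(x)$ as $N\to\infty$. (ii) $\nu$ is a singular Rajchman probability. (iii) All convolution powers $\nu^m$, $m\ge1$, are singular, and $P_\nu$ is not Harris recurrent. (iv) $P_\nu$ is hyperbounded. -/

import Mathlib

open MeasureTheory ProbabilityTheory Filter Topology
open scoped ENNReal NNReal

noncomputable section

namespace HyperboundedMarkov

/-! ### Markov operators on a probability space -/

section Markov

variable {S : Type*} [MeasurableSpace S]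

/-- The operator `P f (x) = ∫ f(y) P(x, dy)` of a transition probability `P`. -/
def markovOp (P : Kernel S S) (f : S → ℂ) (x : S) : ℂ := ∫ y, f y ∂(P x)

/-- `P` is hyperbounded on `(S, μ)`: the measure `μ` is invariant and, for some `1 < p < q ≤ ∞`,
`P` maps `L^p(μ)` continuously into `L^q(μ)`. -/
def IsHyperbounded (μ : Measure S) (P : Kernel S S) : Prop :=
  P.Invariant μ ∧
    ∃ p q : ℝ≥0∞, 1 < p ∧ p < q ∧ ∃ C : ℝ≥0, ∀ f : S → ℂ, MemLp f p μ →
      MemLp (markovOp P f) q μ ∧ eLpNorm (markovOp P f) q μ ≤ C * eLpNorm f p μ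

/-- `Q` dominates a non-zero integral operator `f ↦ ∫ k(x, y) f(y) dμ(y)` with kernel `k ≥ 0`. -/
def BoundsNonzeroIntegralOperator (μ : Measure S) (Q : Kernel S S) : Prop :=
  ∃ k : S → S → ℝ≥0∞, Measurable (Function.uncurry k) ∧
    (∫⁻ x, ∫⁻ y, k x y ∂μ ∂μ) ≠ 0 ∧
    ∀ A : Set S, MeasurableSet A → ∀ᵐ x ∂μ, ∫⁻ y in A, k x y ∂μ ≤ Q x A

/-- Harris recurrence in the analytic (operator-theoretic) sense, for a transition probability `P`
with invariant probability `μ`: some power of `P` dominates a non-zero integral operator.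
Conservativity is automatic when there is an invariant probability. Ergodicity, which is often made
part of the notion, is automatic for convolution operators on the circle with this property;
as it is not required here, the negation of this property is at least as strong as with it. -/
def IsHarrisRecurrent (μ : Measure S) (P : Kernel S S) : Prop :=
  P.Invariant μ ∧ ∃ n : ℕ, 1 ≤ n ∧ BoundsNonzeroIntegralOperator μ (P ^ n)

end Markov

/-! ### Convolutions on the circle `ℝ / ℤ` -/

/-- The normalized Haar measure of the circle. -/
abbrev haar : Measure UnitAddCircle := AddCircle.haarAddCircle

/-- The transition probability of `P_ν`: `P(x, ·)` is the law of `x - y` where `y` has law `ν`. -/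
def convKernel (ν : Measure UnitAddCircle) [IsProbabilityMeasure ν] :
    Kernel UnitAddCircle UnitAddCircle where
  toFun x := ν.map fun y => x - y
  measurable' := by
    refine Measure.measurable_of_measurable_coe _ fun s hs => ?_
    have h : ∀ x : UnitAddCircle,
        (ν.map fun y => x - y) s =
          ν (Prod.mk x ⁻¹' ((fun z : UnitAddCircle × UnitAddCircle => z.1 - z.2) ⁻¹' s)) := by
      intro x
      rw [Measure.map_apply (by fun_prop) hs]
      rfl
    simp_rw [h]
    exact measurable_measure_prodMk_left
      ((measurable_fst.sub measurable_snd) hs)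

/-- `P_ν f = ν * f`. -/
theorem markovOp_convKernel (ν : Measure UnitAddCircle) [IsProbabilityMeasure ν]
    (f : UnitAddCircle → ℂ) (x : UnitAddCircle) :
    markovOp (convKernel ν) f x = ∫ y, f (x - y) ∂ν :=
  integral_map_equiv (MeasurableEquiv.subLeft x) f

/-- The convolution powers of `ν`. -/
def convPow (ν : Measure UnitAddCircle) : ℕ → Measure UnitAddCircle
  | 0 => Measure.dirac 0
  | n + 1 => Measure.conv (convPow ν n) ν

/-- The Fourier-Stieltjes coefficient `ν̂(n) = ∫ e_{-n} dν`. -/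
def fourierStieltjes (ν : Measure UnitAddCircle) (n : ℤ) : ℂ :=
  ∫ x, fourier (-n) x ∂ν

/-- `ν̂(n) → 0` as `|n| → ∞`. -/
def IsRajchman (ν : Measure UnitAddCircle) : Prop :=
  Tendsto (fourierStieltjes ν) cofinite (𝓝 0)

/-- The partial Riesz product `∏_{k < N} (1 + a_k cos(2π n_k x))`. -/
def rieszPartial (a : ℕ → ℝ) (n : ℕ → ℕ) (N : ℕ) (x : UnitAddCircle) : ℝ :=
  ∏ k ∈ Finset.range N, (1 + a k * (fourier (n k : ℤ) x).re)

/-- `ν` is the Riesz product `∏_k (1 + a_k cos(2π n_k x))`, where `a_k` are non-zero numbers in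
`[-1, 1]` and `n_k` are positive integers with `n_{k+1} / n_k ≥ q > 3`: it is the weak limit of
the measures whose densities are the partial products. -/
def IsRieszProduct (ν : Measure UnitAddCircle) (a : ℕ → ℝ) (n : ℕ → ℕ) : Prop :=
  (∀ k, a k ≠ 0 ∧ |a k| ≤ 1) ∧ (∀ k, 0 < n k) ∧
    (∃ q : ℝ, 3 < q ∧ ∀ k, q * (n k : ℝ) ≤ (n (k + 1) : ℝ)) ∧
    ∀ f : C(UnitAddCircle, ℝ),
      Tendsto (fun N => ∫ x, f x * rieszPartial a n N x ∂haar) atTop (𝓝 (∫ x, f x ∂ν))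

end HyperboundedMarkov

end

open MeasureTheory ProbabilityTheory Filter Topology
open scoped ENNReal NNReal

noncomputable section

namespace HyperboundedMarkov

/-! ### Fourier coefficients of Riesz products -/

/-! The example is the Riesz product with n_k = 6^k and a_k = 1/(1 + log(k+1)). Sparsity makes the
windows of radius `freqSum n N` about 0 and ±n_N disjoint, so a coefficient is fixed once its
frequency enters a window (`rieszCoeff_of_le`), and ν̂ is explicit: ν̂(n_k) = a_k/2 and ν̂(n_k -
n_j) = (a_k/2)(a_j/2). A weak limit point exists by compactness, and its coefficients identify it as
the limit of the whole sequence. It is Rajchman because a_k → 0.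

Hyperboundedness: convolution is a contraction from L² to L⁴. Adding one factor writes the new
transform as z + r·b·e_k + r·c·e_{-k}, where |r| ≤ 1/2 and z, b, c have degree much smaller than k.
Its square splits into five orthogonal frequency blocks, so a pointwise inequality
(`norm_add_mul_le_of_le_half`) bounds its fourth moment by ∫ (|z|² + |b|² + |c|²)². Minkowski in L²
and induction close the estimate (`integral_norm_rieszTransform_pow_four_le`); L¹ continuity and
Fatou extend it to all of L².

Singularity: put r_k = (a_k/2)^m. Under ν^m the functions e_{n_k} - r_k are orthogonal, and under
Haar measure so are the e_{n_k}. Averages of both families with weights r_k tend to 0 in the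
respective L² spaces if ∑ r_k² = ∞, yet they differ by exactly 1
(`mutuallySingular_haar_of_tendsto_atTop`). Since a_k decays more slowly than every power, the
divergence holds for every m. A non-zero integral operator below P_ν^m would put an absolutely
continuous part below translates of the reflection of ν^m, which is impossible
(`not_isHarrisRecurrent_convKernel`). -/

/-- The largest frequency of the `N`-th partial Riesz product. -/
def freqSum (n : ℕ → ℕ) (N : ℕ) : ℤ := ∑ k ∈ Finset.range N, (n k : ℤ)

/-- The Fourier coefficients of the `N`-th partial Riesz product, by recursion on `N`. -/
def rieszCoeff (a : ℕ → ℝ) (n : ℕ → ℕ) : ℕ → ℤ → ℝ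
  | 0, w => if w = 0 then 1 else 0
  | N + 1, w => rieszCoeff a n N w +
      a N / 2 * (rieszCoeff a n N (w - n N) + rieszCoeff a n N (w + n N))

/-- Each frequency exceeds four times the sum of the preceding ones. -/
def IsSparse (n : ℕ → ℕ) : Prop := ∀ N, 4 * freqSum n N < n N

lemma freqSum_succ (n : ℕ → ℕ) (N : ℕ) : freqSum n (N + 1) = freqSum n N + n N :=
  Finset.sum_range_succ _ _

lemma freqSum_nonneg (n : ℕ → ℕ) (N : ℕ) : 0 ≤ freqSum n N :=
  Finset.sum_nonneg fun _ _ => Int.natCast_nonneg _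

lemma freqSum_mono (n : ℕ → ℕ) : Monotone (freqSum n) :=
  monotone_nat_of_le_succ fun N => by rw [freqSum_succ]; omega

lemma IsSparse.pos {n : ℕ → ℕ} (hn : IsSparse n) (k : ℕ) : (0 : ℤ) < n k := by
  have := hn k
  have := freqSum_nonneg n k
  omega

lemma IsSparse.le_freqSum {n : ℕ → ℕ} (hn : IsSparse n) (N : ℕ) : (N : ℤ) ≤ freqSum n N := by
  induction N with
  | zero => simp [freqSum]
  | succ N ih =>
    have := hn.pos N
    rw [freqSum_succ]
    push_cast
    omega

lemma le_freqSum_of_lt (n : ℕ → ℕ) {j k : ℕ} (h : j < k) : (n j : ℤ) ≤ freqSum n k := by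
  have h1 := freqSum_mono n (Nat.succ_le_of_lt h)
  have h2 := freqSum_nonneg n j
  rw [Nat.succ_eq_add_one, freqSum_succ] at h1
  omega

section Coeff

variable {a : ℕ → ℝ} {n : ℕ → ℕ}

lemma rieszCoeff_of_freqSum_lt {N : ℕ} {w : ℤ} (hw : freqSum n N < |w|) :
    rieszCoeff a n N w = 0 := by
  induction N generalizing w with
  | zero =>
    have : w ≠ 0 := by rintro rfl; simp [freqSum] at hw
    simp [rieszCoeff, this]
  | succ N ih =>
    rw [freqSum_succ] at hw
    have h0 := freqSum_nonneg n N
    rw [rieszCoeff, ih (by grind), ih (by grind), ih (by grind)]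
    simp

/-- A new factor only adds copies of the old spectrum centred at ±n_N, and sparsity keeps these off
the old window. With the next two lemmas, at most one of the three terms of the recursion is ever
non-zero. -/
lemma rieszCoeff_succ_of_le (hn : IsSparse n) {N : ℕ} {w : ℤ} (hw : |w| ≤ freqSum n N) :
    rieszCoeff a n (N + 1) w = rieszCoeff a n N w := by
  have h0 := freqSum_nonneg n N
  have h1 := hn N
  rw [rieszCoeff, rieszCoeff_of_freqSum_lt (w := w - n N) (by grind),
    rieszCoeff_of_freqSum_lt (w := w + n N) (by grind)]
  simp

lemma rieszCoeff_succ_of_lt {N : ℕ} {w : ℤ} (hw : freqSum n N < w) :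
    rieszCoeff a n (N + 1) w = a N / 2 * rieszCoeff a n N (w - n N) := by
  have h0 := freqSum_nonneg n N
  rw [rieszCoeff, rieszCoeff_of_freqSum_lt (w := w) (by grind),
    rieszCoeff_of_freqSum_lt (w := w + n N) (by grind)]
  simp

lemma rieszCoeff_succ_of_lt_neg {N : ℕ} {w : ℤ} (hw : w < -freqSum n N) :
    rieszCoeff a n (N + 1) w = a N / 2 * rieszCoeff a n N (w + n N) := by
  have h0 := freqSum_nonneg n N
  rw [rieszCoeff, rieszCoeff_of_freqSum_lt (w := w) (by grind),
    rieszCoeff_of_freqSum_lt (w := w - n N) (by grind)]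
  simp

/-- Hence every coefficient is eventually constant in the stage, and the final value gives the
coefficient of the limit measure. -/
lemma rieszCoeff_of_le (hn : IsSparse n) {N M : ℕ} (hNM : N ≤ M) {w : ℤ}
    (hw : |w| ≤ freqSum n N) : rieszCoeff a n M w = rieszCoeff a n N w := by
  induction M, hNM using Nat.le_induction with
  | base => rfl
  | succ M hM ih => rw [rieszCoeff_succ_of_le hn (hw.trans (freqSum_mono n hM)), ih]

lemma rieszCoeff_zero (hn : IsSparse n) (N : ℕ) : rieszCoeff a n N 0 = 1 := by
  rw [rieszCoeff_of_le hn (Nat.zero_le N) (by simp [freqSum])]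
  simp [rieszCoeff]

lemma rieszCoeff_neg (N : ℕ) (w : ℤ) : rieszCoeff a n N (-w) = rieszCoeff a n N w := by
  induction N generalizing w with
  | zero => simp [rieszCoeff]
  | succ N ih =>
    rw [rieszCoeff, rieszCoeff, ih w, show -w - (n N : ℤ) = -(w + n N) by ring, ih,
      show -w + (n N : ℤ) = -(w - n N) by ring, ih]
    ring

lemma abs_rieszCoeff_le_one (hn : IsSparse n) (ha : ∀ k, |a k| ≤ 1) (N : ℕ) (w : ℤ) :
    |rieszCoeff a n N w| ≤ 1 := by
  induction N generalizing w with
  | zero => rw [rieszCoeff]; split_ifs <;> simp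
  | succ N ih =>
    have key : ∀ v, |a N / 2 * rieszCoeff a n N v| ≤ 1 := fun v => by
      rw [abs_mul, abs_div, abs_two]
      exact mul_le_one₀ (by linarith [ha N]) (abs_nonneg _) (ih v)
    rcases le_or_gt |w| (freqSum n N) with h | h
    · rw [rieszCoeff_succ_of_le hn h]; exact ih w
    · rcases lt_abs.1 h with h | h
      · rw [rieszCoeff_succ_of_lt h]; exact key _
      · rw [rieszCoeff_succ_of_lt_neg (by omega)]; exact key _

/-- A frequency outside the window of stage N can acquire a non-zero coefficient only at a later
stage M ≥ N, where it carries a factor a_M/2; the other factor is at most 1. This is the source of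
the Rajchman property. -/
lemma abs_rieszCoeff_le (hn : IsSparse n) (ha : ∀ k, |a k| ≤ 1) {N : ℕ} {ε : ℝ} (hε : 0 ≤ ε)
    (hN : ∀ k ≥ N, |a k| ≤ ε) {w : ℤ} (hw : freqSum n N < |w|) (M : ℕ) :
    |rieszCoeff a n M w| ≤ ε := by
  induction M with
  | zero =>
    rw [rieszCoeff_of_freqSum_lt ((freqSum_mono n (Nat.zero_le N)).trans_lt hw)]
    simpa
  | succ M ih =>
    rcases le_or_gt (M + 1) N with hM | hM
    · rw [rieszCoeff_of_freqSum_lt ((freqSum_mono n hM).trans_lt hw)]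
      simpa
    have key : ∀ v, |a M / 2 * rieszCoeff a n M v| ≤ ε := fun v => by
      rw [abs_mul, abs_div, abs_two]
      have h1 := hN M (by omega)
      calc |a M| / 2 * |rieszCoeff a n M v| ≤ |a M| / 2 * 1 := by
            gcongr; exact abs_rieszCoeff_le_one hn ha M v
        _ ≤ ε := by linarith
    rcases le_or_gt |w| (freqSum n M) with h | h
    · rw [rieszCoeff_succ_of_le hn h]; exact ih
    · rcases lt_abs.1 h with h | h
      · rw [rieszCoeff_succ_of_lt h]; exact key _
      · rw [rieszCoeff_succ_of_lt_neg (by omega)]; exact key _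

lemma rieszCoeff_freq (hn : IsSparse n) (k : ℕ) : rieszCoeff a n (k + 1) (n k) = a k / 2 := by
  have h0 := freqSum_nonneg n k
  have h1 := hn k
  rw [rieszCoeff_succ_of_lt (by omega), sub_self, rieszCoeff_zero hn, mul_one]

lemma rieszCoeff_freq_sub (hn : IsSparse n) {j k : ℕ} (h : j < k) :
    rieszCoeff a n (k + 1) (n k - n j) = a k / 2 * (a j / 2) := by
  have h0 := le_freqSum_of_lt n h
  have h1 := hn k
  have h2 : |(n j : ℤ)| ≤ freqSum n (j + 1) := by
    rw [Nat.abs_cast]; exact le_freqSum_of_lt n (Nat.lt_succ_self j)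
  rw [rieszCoeff_succ_of_lt (by omega), show (n k - n j - n k : ℤ) = -n j by ring,
    rieszCoeff_neg, rieszCoeff_of_le hn h h2, rieszCoeff_freq hn]

end Coeff

/-! ### Integrals of characters -/

lemma integral_fourier (w : ℤ) :
    ∫ x : UnitAddCircle, fourier w x ∂haar = if w = 0 then 1 else 0 := by
  have h := congrFun (fourierCoeff_fourier (T := (1 : ℝ)) w) 0
  simp only [fourierCoeff, neg_zero, fourier_zero, one_smul, Pi.single_apply] at h
  rw [h]
  exact if_congr eq_comm rfl rfl

lemma integrable_of_continuous {X E : Type*} [TopologicalSpace X] [CompactSpace X]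
    [MeasurableSpace X] [OpensMeasurableSpace X]
    [NormedAddCommGroup E] [SecondCountableTopologyEither X E]
    {f : X → E} (hf : Continuous f) (μ : Measure X) [IsFiniteMeasure μ] : Integrable f μ :=
  hf.integrable_of_hasCompactSupport (HasCompactSupport.of_compactSpace f)

lemma norm_fourier_apply (w : ℤ) (x : UnitAddCircle) : ‖fourier w x‖ = 1 := by
  rw [fourier_apply]; exact Circle.norm_coe _

lemma fourier_re_eq (w : ℤ) (x : UnitAddCircle) :
    (((fourier w x).re : ℝ) : ℂ) = (fourier w x + fourier (-w) x) / 2 := by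
  rw [fourier_neg, Complex.re_eq_add_conj]

lemma continuous_rieszPartial (a : ℕ → ℝ) (n : ℕ → ℕ) (N : ℕ) :
    Continuous (rieszPartial a n N) := by
  unfold rieszPartial
  refine continuous_finsetProd _ fun k _ => ?_
  exact continuous_const.add
    (continuous_const.mul (Complex.continuous_re.comp (fourier (n k : ℤ)).continuous))

lemma rieszPartial_nonneg {a : ℕ → ℝ} (ha : ∀ k, |a k| ≤ 1) (n : ℕ → ℕ) (N : ℕ)
    (x : UnitAddCircle) : 0 ≤ rieszPartial a n N x := by
  refine Finset.prod_nonneg fun k _ => ?_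
  have h1 : |(fourier (n k : ℤ) x).re| ≤ 1 :=
    (Complex.abs_re_le_norm _).trans (norm_fourier_apply _ x).le
  have h2 : |a k * (fourier (n k : ℤ) x).re| ≤ 1 := by
    rw [abs_mul]; exact mul_le_one₀ (ha k) (abs_nonneg _) h1
  linarith [neg_le_of_abs_le h2]

/-- Writing the cosine of the last factor as half of e_{n_N} + e_{-n_N} turns multiplication by it
into the recursion of `rieszCoeff`. -/
lemma integral_fourier_mul_rieszPartial (a : ℕ → ℝ) (n : ℕ → ℕ) (N : ℕ) (w : ℤ) :
    ∫ x, fourier (-w) x * (rieszPartial a n N x : ℂ) ∂haar = rieszCoeff a n N w := by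
  induction N generalizing w with
  | zero =>
    simp only [rieszPartial, Finset.range_zero, Finset.prod_empty, Complex.ofReal_one, mul_one,
      integral_fourier, rieszCoeff, neg_eq_zero]
    split_ifs <;> simp
  | succ N ih =>
    have hi : ∀ v : ℤ, Integrable
        (fun x : UnitAddCircle => fourier v x * (rieszPartial a n N x : ℂ)) haar := fun v =>
      integrable_of_continuous ((fourier v).continuous.mul
        (Complex.continuous_ofReal.comp (continuous_rieszPartial a n N))) _
    have h : ∀ x : UnitAddCircle, fourier (-w) x * (rieszPartial a n (N + 1) x : ℂ) =
        fourier (-w) x * (rieszPartial a n N x : ℂ) + (a N / 2 : ℂ) *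
          (fourier (-(w - n N)) x * (rieszPartial a n N x : ℂ)
            + fourier (-(w + n N)) x * (rieszPartial a n N x : ℂ)) := fun x => by
      have h1 : rieszPartial a n (N + 1) x =
          rieszPartial a n N x * (1 + a N * (fourier (n N : ℤ) x).re) :=
        Finset.prod_range_succ _ _
      rw [h1, show -(w - (n N : ℤ)) = -w + n N by ring, show -(w + (n N : ℤ)) = -w + -n N by ring,
        fourier_add, fourier_add]
      push_cast
      rw [fourier_re_eq]
      ring
    simp_rw [h]
    have hi2 : Integrable (fun x : UnitAddCircle => (a N / 2 : ℂ) *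
          (fourier (-(w - n N)) x * (rieszPartial a n N x : ℂ)
            + fourier (-(w + n N)) x * (rieszPartial a n N x : ℂ))) haar :=
      ((hi _).add (hi _)).const_mul _
    rw [integral_add (hi _) hi2, integral_const_mul,
      integral_add (hi _) (hi _), ih, ih, ih, rieszCoeff]
    push_cast
    ring

/-! ### Trigonometric polynomials -/

/-- The trigonometric polynomials of degree at most `d`. -/
def trigPoly (d : ℤ) : Submodule ℂ C(UnitAddCircle, ℂ) :=
  Submodule.span ℂ (fourier '' {m : ℤ | |m| ≤ d})

lemma fourier_mem_trigPoly {d m : ℤ} (h : |m| ≤ d) :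
    (fourier m : C(UnitAddCircle, ℂ)) ∈ trigPoly d :=
  Submodule.subset_span ⟨m, h, rfl⟩

lemma mul_mem_trigPoly {d d' : ℤ} {f g : C(UnitAddCircle, ℂ)} (hf : f ∈ trigPoly d)
    (hg : g ∈ trigPoly d') : f * g ∈ trigPoly (d + d') := by
  have h : f * g ∈ trigPoly d * trigPoly d' := Submodule.mul_mem_mul hf hg
  rw [trigPoly, trigPoly, Submodule.span_mul_span] at h
  refine Submodule.span_mono ?_ h
  rintro _ ⟨_, ⟨m, hm, rfl⟩, _, ⟨m', hm', rfl⟩, rfl⟩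
  refine ⟨m + m', (abs_add_le m m').trans (add_le_add hm hm'), ?_⟩
  ext x
  simp

lemma star_mem_trigPoly {d : ℤ} {f : C(UnitAddCircle, ℂ)} (hf : f ∈ trigPoly d) :
    star f ∈ trigPoly d := by
  induction hf using Submodule.span_induction with
  | mem f hf =>
    obtain ⟨m, hm, rfl⟩ := hf
    have : star (fourier m : C(UnitAddCircle, ℂ)) = fourier (-m) := by
      ext x; simp
    rw [this]
    exact fourier_mem_trigPoly (by simpa using hm)
  | zero => simp
  | add f g _ _ hf hg => rw [star_add]; exact add_mem hf hg
  | smul c f _ hf => rw [star_smul]; exact Submodule.smul_mem _ _ hf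

lemma integral_trigPoly_mul_fourier {d k : ℤ} (hk : d < |k|) {f : C(UnitAddCircle, ℂ)}
    (hf : f ∈ trigPoly d) : ∫ x, f x * fourier k x ∂haar = 0 := by
  induction hf using Submodule.span_induction with
  | mem f hf =>
    obtain ⟨m, hm, rfl⟩ := hf
    simp_rw [← fourier_add]
    rw [integral_fourier, if_neg]
    have : |m| ≤ d := hm
    grind
  | zero => simp
  | add f g _ _ hf hg =>
    simp only [ContinuousMap.add_apply, add_mul]
    rw [integral_add, hf, hg, add_zero] <;> exact integrable_of_continuous (by fun_prop) _
  | smul c f _ hf =>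
    simp only [ContinuousMap.smul_apply, smul_eq_mul, mul_assoc]
    rw [integral_const_mul, hf, mul_zero]

lemma ofReal_norm_sq (z : ℂ) : ((‖z‖ ^ 2 : ℝ) : ℂ) = z * star z := by
  rw [Complex.star_def, Complex.mul_conj']; push_cast; rfl

/-- Trigonometric polynomials carried to far-apart frequency blocks are orthogonal. -/
lemma integral_norm_sq_sum_blocks {ι : Type*} (s : Finset ι) {d : ℤ}
    (A : ι → C(UnitAddCircle, ℂ)) (hA : ∀ i ∈ s, A i ∈ trigPoly d) (m : ι → ℤ)
    (hm : ∀ i ∈ s, ∀ j ∈ s, i ≠ j → d + d < |m i - m j|) :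
    ∫ x, ‖∑ i ∈ s, A i x * fourier (m i) x‖ ^ 2 ∂haar = ∑ i ∈ s, ∫ x, ‖A i x‖ ^ 2 ∂haar := by
  classical
  apply Complex.ofReal_injective
  rw [← integral_complex_ofReal, Complex.ofReal_sum]
  simp_rw [← integral_complex_ofReal, ofReal_norm_sq]
  have h : ∀ x : UnitAddCircle,
      (∑ i ∈ s, A i x * fourier (m i) x) * star (∑ i ∈ s, A i x * fourier (m i) x) =
      ∑ i ∈ s, ∑ j ∈ s, (A i * star (A j)) x * fourier (m i - m j) x := fun x => by
    rw [star_sum, Finset.sum_mul_sum]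
    refine Finset.sum_congr rfl fun i _ => Finset.sum_congr rfl fun j _ => ?_
    rw [sub_eq_add_neg, fourier_add, fourier_neg, star_mul']
    simp only [ContinuousMap.mul_apply, ContinuousMap.star_apply, Complex.star_def]
    ring
  simp_rw [h]
  rw [integral_finsetSum _ fun i _ => integrable_of_continuous (by fun_prop) _]
  refine Finset.sum_congr rfl fun i hi => ?_
  rw [integral_finsetSum _ fun j _ => integrable_of_continuous (by fun_prop) _,
    Finset.sum_eq_single i]
  · simp
  · intro j hj hji
    exact integral_trigPoly_mul_fourier (hm i hi j hj hji.symm)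
      (mul_mem_trigPoly (hA i hi) (star_mem_trigPoly (hA j hj)))
  · exact fun h => absurd hi h

/-! ### The two-point inequality -/

/-- The left side is the sum of the squared moduli of the five frequency blocks of (z + rb·e_k +
rc·e_{-k})². After AM-GM on the term in |b||c|, the mixed terms need 6r² ≤ 2, and r² ≤ 1/4 leaves
room. -/
lemma norm_add_mul_le_of_le_half (z b c : ℂ) {r : ℝ} (hr : |r| ≤ 1 / 2) :
    ‖z ^ 2 + 2 * (r * b) * (r * c)‖ ^ 2 + ‖2 * z * (r * b)‖ ^ 2 + ‖2 * z * (r * c)‖ ^ 2 +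
      ‖(r * b) ^ 2‖ ^ 2 + ‖(r * c) ^ 2‖ ^ 2 ≤ (‖z‖ ^ 2 + ‖b‖ ^ 2 + ‖c‖ ^ 2) ^ 2 := by
  have h1 : ‖z ^ 2 + 2 * (r * b) * (r * c)‖ ≤ ‖z‖ ^ 2 + 2 * r ^ 2 * ‖b‖ * ‖c‖ := by
    refine (norm_add_le _ _).trans_eq ?_
    simp only [norm_pow, norm_mul, Complex.norm_real, Real.norm_eq_abs, RCLike.norm_ofNat]
    rw [← sq_abs r]; ring
  have h2 : r ^ 2 ≤ 1 / 4 := by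
    rw [← sq_abs]; nlinarith [abs_nonneg r]
  have h3 : ‖z ^ 2 + 2 * (r * b) * (r * c)‖ ^ 2 ≤ (‖z‖ ^ 2 + 2 * r ^ 2 * ‖b‖ * ‖c‖) ^ 2 := by
    gcongr
  simp only [norm_pow, norm_mul, Complex.norm_real, Real.norm_eq_abs, RCLike.norm_ofNat,
    mul_pow, sq_abs] at h3 ⊢
  generalize ‖z‖ = x at *
  generalize ‖b‖ = y at *
  generalize ‖c‖ = t at *
  have h0 : 0 ≤ r ^ 2 := sq_nonneg r
  generalize r ^ 2 = q at *
  have e1 : 4 * q * x ^ 2 * (y * t) ≤ 2 * q * x ^ 2 * (y ^ 2 + t ^ 2) := by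
    have : 0 ≤ 2 * q * x ^ 2 * (y - t) ^ 2 := by positivity
    nlinarith
  have e2 : 6 * q * x ^ 2 * (y ^ 2 + t ^ 2) ≤ 2 * x ^ 2 * (y ^ 2 + t ^ 2) := by
    have : 0 ≤ x ^ 2 * (y ^ 2 + t ^ 2) := by positivity
    nlinarith
  have e3 : q ^ 2 * (4 * y ^ 2 * t ^ 2 + y ^ 4 + t ^ 4) ≤ (y ^ 2 + t ^ 2) ^ 2 := by
    have h5 : q ^ 2 ≤ 1 / 2 := by nlinarith
    have : 0 ≤ 4 * y ^ 2 * t ^ 2 + y ^ 4 + t ^ 4 := by positivity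
    have h6 := mul_le_mul_of_nonneg_right h5 this
    have : 0 ≤ y ^ 4 + t ^ 4 := by positivity
    nlinarith
  nlinarith

/-! ### The `L² → L⁴` inequality for partial Riesz products -/

/-- Minkowski's inequality in L², from the pointwise weighted bound (u+v)² ≤ (1 + D/C)u² + (1 +
C/D)v². -/
lemma integral_sq_sum_le {X : Type*} [TopologicalSpace X] [CompactSpace X] [MeasurableSpace X]
    [OpensMeasurableSpace X] (μ : Measure X) [IsFiniteMeasure μ] {u v : X → ℝ}
    (hu : Continuous u) (hv : Continuous v) {C D : ℝ} (hC : 0 ≤ C) (hD : 0 ≤ D)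
    (hu2 : ∫ x, u x ^ 2 ∂μ ≤ C ^ 2) (hv2 : ∫ x, v x ^ 2 ∂μ ≤ D ^ 2) :
    ∫ x, (u x + v x) ^ 2 ∂μ ≤ (C + D) ^ 2 := by
  -- The weights D/C and C/D need positive C and D, so both are enlarged by ε and ε → 0 at the end.
  have key : ∀ ε > 0, ∫ x, (u x + v x) ^ 2 ∂μ ≤ ((C + ε) + (D + ε)) ^ 2 := by
    intro ε hε
    set C' := C + ε
    set D' := D + ε
    have hC' : 0 < C' := by positivity
    have hD' : 0 < D' := by positivity
    have h : ∀ x, (u x + v x) ^ 2 ≤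
        (1 + D' / C') * u x ^ 2 + (1 + C' / D') * v x ^ 2 := fun x => by
      have : 0 ≤ (D' * u x - C' * v x) ^ 2 / (C' * D') := by positivity
      have e : (1 + D' / C') * u x ^ 2 + (1 + C' / D') * v x ^ 2 - (u x + v x) ^ 2 =
        (D' * u x - C' * v x) ^ 2 / (C' * D') := by field_simp; ring
      linarith
    calc ∫ x, (u x + v x) ^ 2 ∂μ
        ≤ ∫ x, (1 + D' / C') * u x ^ 2 + (1 + C' / D') * v x ^ 2 ∂μ :=
          integral_mono (integrable_of_continuous (by fun_prop) _)
            (integrable_of_continuous (by fun_prop) _) h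
      _ = (1 + D' / C') * ∫ x, u x ^ 2 ∂μ + (1 + C' / D') * ∫ x, v x ^ 2 ∂μ := by
          rw [integral_add (integrable_of_continuous (by fun_prop) _)
            (integrable_of_continuous (by fun_prop) _), integral_const_mul, integral_const_mul]
      _ ≤ (1 + D' / C') * C' ^ 2 + (1 + C' / D') * D' ^ 2 := by
          gcongr
          · exact hu2.trans (by gcongr; simp [C', hε.le])
          · exact hv2.trans (by gcongr; simp [D', hε.le])
      _ = (C' + D') ^ 2 := by field_simp; ring
  have hlim : Tendsto (fun ε : ℝ => ((C + ε) + (D + ε)) ^ 2) (𝓝[>] 0) (𝓝 ((C + D) ^ 2)) := by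
    have : Continuous fun ε : ℝ => ((C + ε) + (D + ε)) ^ 2 := by fun_prop
    simpa using (this.tendsto 0).mono_left nhdsWithin_le_nhds
  exact ge_of_tendsto hlim (eventually_mem_nhdsWithin.mono key)

/-- The convolution of the `N`-th partial Riesz product with the series with coefficients `c`. -/
def rieszTransform (a : ℕ → ℝ) (n : ℕ → ℕ) (N : ℕ) (c : ℤ → ℂ) : C(UnitAddCircle, ℂ) :=
  ∑ w ∈ Finset.Icc (-freqSum n N) (freqSum n N), ((rieszCoeff a n N w : ℂ) * c w) • fourier w

lemma rieszTransform_mem (a : ℕ → ℝ) (n : ℕ → ℕ) (N : ℕ) (c : ℤ → ℂ) :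
    rieszTransform a n N c ∈ trigPoly (freqSum n N) :=
  sum_mem fun _ hw => Submodule.smul_mem _ _
    (fourier_mem_trigPoly (abs_le.2 (Finset.mem_Icc.1 hw)))

lemma sum_rieszCoeff_shift {E : Type*} [AddCommGroup E] [Module ℂ E] (a : ℕ → ℝ) (n : ℕ → ℕ)
    (N : ℕ) (v : ℤ) (hv : |v| ≤ n N) (F : ℤ → E) :
    ∑ w ∈ Finset.Icc (-freqSum n (N + 1)) (freqSum n (N + 1)),
        (rieszCoeff a n N (w - v) : ℂ) • F w =
      ∑ w ∈ Finset.Icc (-freqSum n N) (freqSum n N),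
        (rieszCoeff a n N w : ℂ) • F (w + v) := by
  have h : ∑ w ∈ Finset.Icc (-freqSum n N) (freqSum n N),
        (rieszCoeff a n N w : ℂ) • F (w + v) =
      ∑ w ∈ (Finset.Icc (-freqSum n N) (freqSum n N)).map (addRightEmbedding v),
        (rieszCoeff a n N (w - v) : ℂ) • F w := by
    rw [Finset.sum_map]; simp
  rw [h]
  symm
  refine Finset.sum_subset ?_ fun w _ hw => ?_
  · intro w hw
    simp only [Finset.mem_map, Finset.mem_Icc, addRightEmbedding_apply] at hw ⊢
    rw [freqSum_succ]
    grind
  · rw [rieszCoeff_of_freqSum_lt]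
    · simp
    · by_contra! hlt
      apply hw
      simp only [Finset.mem_map, Finset.mem_Icc, addRightEmbedding_apply]
      exact ⟨w - v, abs_le.1 hlt, by ring⟩

/-- The shift by ±n_N is moved from the coefficients of the product to the sequence `c`, so all
three pieces are transforms of stage N. The induction on N must therefore range over all `c`. -/
lemma rieszTransform_succ (a : ℕ → ℝ) (n : ℕ → ℕ) (N : ℕ) (c : ℤ → ℂ) (x : UnitAddCircle) :
    rieszTransform a n (N + 1) c x = rieszTransform a n N c x +
      ((a N / 2 : ℝ) * rieszTransform a n N (fun w => c (w + n N)) x) * fourier (n N : ℤ) x +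
      ((a N / 2 : ℝ) * rieszTransform a n N (fun w => c (w - n N)) x) *
        fourier (-(n N : ℤ)) x := by
  have e0 := sum_rieszCoeff_shift a n N 0 (by simp) fun w => c w * fourier w x
  have e1 := sum_rieszCoeff_shift a n N (n N) (by simp) fun w => c w * fourier w x
  have e2 := sum_rieszCoeff_shift a n N (-n N) (by simp) fun w => c w * fourier w x
  simp only [sub_zero, add_zero, smul_eq_mul, fourier_add, sub_neg_eq_add] at e0 e1 e2
  simp only [rieszTransform, ContinuousMap.sum_apply, ContinuousMap.smul_apply, smul_eq_mul,
    Finset.mul_sum, Finset.sum_mul]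
  have h : ∀ w : ℤ, ((rieszCoeff a n (N + 1) w : ℂ) * c w) * fourier w x =
      rieszCoeff a n N w * (c w * fourier w x) +
      (a N / 2 : ℝ) * (rieszCoeff a n N (w - n N) * (c w * fourier w x)) +
      (a N / 2 : ℝ) * (rieszCoeff a n N (w + n N) * (c w * fourier w x)) := fun w => by
    rw [rieszCoeff]; push_cast; ring
  simp_rw [h]
  rw [Finset.sum_add_distrib, Finset.sum_add_distrib, ← Finset.mul_sum, ← Finset.mul_sum,
    e0, e1, e2, Finset.mul_sum, Finset.mul_sum]
  congr 1
  · congr 1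
    · exact Finset.sum_congr rfl fun w _ => by ring
    · exact Finset.sum_congr rfl fun w _ => by ring
  · exact Finset.sum_congr rfl fun w _ => by rw [sub_eq_add_neg]; ring

/-- Expansion of the fourth power norm along widely separated frequency blocks. -/
lemma integral_norm_pow_four_le {d k : ℤ} (hk : 4 * d < k) (hd : 0 ≤ d) {r : ℝ}
    (hr : |r| ≤ 1 / 2) {z b c : C(UnitAddCircle, ℂ)} (hz : z ∈ trigPoly d) (hb : b ∈ trigPoly d)
    (hc : c ∈ trigPoly d) :
    ∫ x, ‖z x + (r * b x) * fourier k x + (r * c x) * fourier (-k) x‖ ^ 4 ∂haar ≤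
      ∫ x, (‖z x‖ ^ 2 + ‖b x‖ ^ 2 + ‖c x‖ ^ 2) ^ 2 ∂haar := by
  set b' : C(UnitAddCircle, ℂ) := (r : ℂ) • b with hb'
  set c' : C(UnitAddCircle, ℂ) := (r : ℂ) • c with hc'
  have hb2 : b' ∈ trigPoly d := Submodule.smul_mem _ _ hb
  have hc2 : c' ∈ trigPoly d := Submodule.smul_mem _ _ hc
  -- The coefficients of e_0, e_k, e_{-k}, e_{2k}, e_{-2k} in the square. Each has degree at most 2d
  -- and the centres are at least k apart, so 4d < k is exactly what block orthogonality asks for.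
  set A : Fin 5 → C(UnitAddCircle, ℂ) :=
    ![z * z + (2 : ℂ) • (b' * c'), (2 : ℂ) • (z * b'), (2 : ℂ) • (z * c'), b' * b', c' * c']
    with hA
  have hAmem : ∀ i ∈ Finset.univ, A i ∈ trigPoly (d + d) := fun i _ => by
    fin_cases i
    · exact add_mem (mul_mem_trigPoly hz hz) (Submodule.smul_mem _ _ (mul_mem_trigPoly hb2 hc2))
    · exact Submodule.smul_mem _ _ (mul_mem_trigPoly hz hb2)
    · exact Submodule.smul_mem _ _ (mul_mem_trigPoly hz hc2)
    · exact mul_mem_trigPoly hb2 hb2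
    · exact mul_mem_trigPoly hc2 hc2
  have h := integral_norm_sq_sum_blocks Finset.univ A hAmem ![0, k, -k, k + k, -k + -k]
    (fun i _ j _ hij => by
      fin_cases i <;> fin_cases j <;> first | exact absurd rfl hij | (simp; grind))
  have hx : ∀ x : UnitAddCircle,
      ‖z x + (r * b x) * fourier k x + (r * c x) * fourier (-k) x‖ ^ 4 =
      ‖∑ i, A i x * fourier ((![0, k, -k, k + k, -k + -k] : Fin 5 → ℤ) i) x‖ ^ 2 := fun x => by
    have hkk : (fourier k x : ℂ) * fourier (-k) x = 1 := by
      rw [← fourier_add, add_neg_cancel, fourier_zero]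
    rw [show ∀ t : ℝ, t ^ 4 = (t ^ 2) ^ 2 from fun t => by ring, ← norm_pow]
    congr 2
    simp only [Fin.sum_univ_five, hA, hb', hc', Matrix.cons_val, fourier_add, fourier_zero,
      ContinuousMap.add_apply, ContinuousMap.mul_apply, ContinuousMap.smul_apply, smul_eq_mul]
    linear_combination (2 * r ^ 2 * b x * c x) * hkk
  simp_rw [hx]
  rw [h, ← integral_finsetSum _ fun i _ => integrable_of_continuous (by fun_prop) _]
  refine integral_mono (integrable_of_continuous (by fun_prop) _)
    (integrable_of_continuous (by fun_prop) _) fun x => ?_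
  have := norm_add_mul_le_of_le_half (z x) (b x) (c x) hr
  simp only [Fin.sum_univ_five, hA, hb', hc', Matrix.cons_val,
      ContinuousMap.add_apply, ContinuousMap.mul_apply, ContinuousMap.smul_apply, smul_eq_mul]
  simpa only [sq, mul_assoc] using this

/-- The windows about 0 and ±n_N are disjoint and lie in the window of the next stage. -/
lemma sum_Icc_shift_le {n : ℕ → ℕ} (hn : IsSparse n) (N : ℕ) (F : ℤ → ℝ) (hF : ∀ w, 0 ≤ F w) :
    ∑ w ∈ Finset.Icc (-freqSum n N) (freqSum n N), F w +
      ∑ w ∈ Finset.Icc (-freqSum n N) (freqSum n N), F (w + n N) +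
      ∑ w ∈ Finset.Icc (-freqSum n N) (freqSum n N), F (w - n N) ≤
    ∑ w ∈ Finset.Icc (-freqSum n (N + 1)) (freqSum n (N + 1)), F w := by
  set I := Finset.Icc (-freqSum n N) (freqSum n N) with hI
  have h0 := freqSum_nonneg n N
  have h1 := hn N
  have e1 : ∑ w ∈ I, F (w + n N) = ∑ w ∈ I.map (addRightEmbedding (n N : ℤ)), F w := by
    rw [Finset.sum_map]; simp
  have e2 : ∑ w ∈ I, F (w - n N) = ∑ w ∈ I.map (addRightEmbedding (-(n N : ℤ))), F w := by
    rw [Finset.sum_map]; simp [sub_eq_add_neg]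
  rw [e1, e2, ← Finset.sum_union, ← Finset.sum_union]
  · refine Finset.sum_le_sum_of_subset_of_nonneg ?_ fun _ _ _ => hF _
    intro w hw
    simp only [Finset.mem_union, Finset.mem_map, addRightEmbedding_apply, hI, Finset.mem_Icc] at hw ⊢
    rw [freqSum_succ]
    grind
  · rw [Finset.disjoint_left]
    intro w hw
    simp only [Finset.mem_union, Finset.mem_map, addRightEmbedding_apply, hI, Finset.mem_Icc] at hw ⊢
    grind
  · rw [Finset.disjoint_left]
    intro w hw
    simp only [Finset.mem_map, addRightEmbedding_apply, hI, Finset.mem_Icc] at hw ⊢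
    grind

/-- Convolution with a partial Riesz product is a contraction from `L²` to `L⁴`. -/
theorem integral_norm_rieszTransform_pow_four_le {a : ℕ → ℝ} {n : ℕ → ℕ} (hn : IsSparse n)
    (ha : ∀ k, |a k| ≤ 1) (N : ℕ) (c : ℤ → ℂ) :
    ∫ x, ‖rieszTransform a n N c x‖ ^ 4 ∂haar ≤
      (∑ w ∈ Finset.Icc (-freqSum n N) (freqSum n N), ‖c w‖ ^ 2) ^ 2 := by
  induction N generalizing c with
  | zero =>
    simp [rieszTransform, freqSum, rieszCoeff, ← pow_mul]
  | succ N ih =>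
    simp_rw [rieszTransform_succ]
    refine (integral_norm_pow_four_le (hn N) (freqSum_nonneg n N) (r := a N / 2)
      (by rw [abs_div, abs_two]; linarith [ha N]) (rieszTransform_mem a n N _)
      (rieszTransform_mem a n N _) (rieszTransform_mem a n N _)).trans ?_
    have ih' : ∀ c : ℤ → ℂ, ∫ x, (‖rieszTransform a n N c x‖ ^ 2) ^ 2 ∂haar ≤
        (∑ w ∈ Finset.Icc (-freqSum n N) (freqSum n N), ‖c w‖ ^ 2) ^ 2 := fun c => by
      simpa only [← pow_mul] using ih c
    -- Minkowski is applied twice to the functions |·|², whose L² norms are the squared L⁴ norms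
    -- controlled by induction.
    refine (integral_sq_sum_le haar (by fun_prop) (by fun_prop) (by positivity) (by positivity)
      (integral_sq_sum_le haar (by fun_prop) (by fun_prop) (by positivity) (by positivity)
        (ih' _) (ih' _)) (ih' _)).trans ?_
    have h := sum_Icc_shift_le hn N (fun w => ‖c w‖ ^ 2) fun w => by positivity
    gcongr

/-! ### Existence of the Riesz product -/

section Existence

variable {a : ℕ → ℝ} {n : ℕ → ℕ}

/-- The measure whose density is the `N`-th partial Riesz product. -/
def rieszPartialMeasure (a : ℕ → ℝ) (n : ℕ → ℕ) (N : ℕ) : Measure UnitAddCircle :=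
  haar.withDensity fun x => ENNReal.ofReal (rieszPartial a n N x)

lemma integral_rieszPartialMeasure {E : Type*} [NormedAddCommGroup E] [NormedSpace ℝ E]
    (ha : ∀ k, |a k| ≤ 1) (N : ℕ) (f : UnitAddCircle → E) :
    ∫ x, f x ∂rieszPartialMeasure a n N = ∫ x, rieszPartial a n N x • f x ∂haar := by
  rw [rieszPartialMeasure, integral_withDensity_eq_integral_toReal_smul
    (continuous_rieszPartial a n N).measurable.ennreal_ofReal (by simp)]
  simp_rw [ENNReal.toReal_ofReal (rieszPartial_nonneg ha n N _)]

lemma integral_rieszPartial (hn : IsSparse n) (N : ℕ) : ∫ x, rieszPartial a n N x ∂haar = 1 := by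
  have h := integral_fourier_mul_rieszPartial a n N 0
  simp only [neg_zero, fourier_zero, one_mul, rieszCoeff_zero hn] at h
  rw [integral_complex_ofReal] at h
  exact_mod_cast h

lemma isProbabilityMeasure_rieszPartialMeasure (hn : IsSparse n) (ha : ∀ k, |a k| ≤ 1) (N : ℕ) :
    IsProbabilityMeasure (rieszPartialMeasure a n N) := by
  constructor
  rw [rieszPartialMeasure, withDensity_apply _ MeasurableSet.univ, Measure.restrict_univ,
    ← ofReal_integral_eq_lintegral_ofReal
      (integrable_of_continuous (continuous_rieszPartial a n N) _)
      (Eventually.of_forall (rieszPartial_nonneg ha n N)), integral_rieszPartial hn]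
  simp

lemma fourierStieltjes_rieszPartialMeasure (ha : ∀ k, |a k| ≤ 1) (N : ℕ) (w : ℤ) :
    fourierStieltjes (rieszPartialMeasure a n N) w = rieszCoeff a n N w := by
  rw [fourierStieltjes, integral_rieszPartialMeasure ha, ← integral_fourier_mul_rieszPartial]
  refine integral_congr_ae (Eventually.of_forall fun x => ?_)
  simp only [Complex.real_smul]
  ring

/-- Pointwise convergence of the Fourier-Stieltjes coefficients of probabilities implies
convergence of the integrals of continuous functions. -/
lemma tendsto_integral_of_tendsto_fourierStieltjes {ι : Type*} {l : Filter ι}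
    {μ : ι → Measure UnitAddCircle} [∀ i, IsProbabilityMeasure (μ i)]
    {ν : Measure UnitAddCircle} [IsProbabilityMeasure ν]
    (h : ∀ w, Tendsto (fun i => fourierStieltjes (μ i) w) l (𝓝 (fourierStieltjes ν w)))
    (f : C(UnitAddCircle, ℂ)) :
    Tendsto (fun i => ∫ x, f x ∂μ i) l (𝓝 (∫ x, f x ∂ν)) := by
  have hspan : ∀ g ∈ Submodule.span ℂ (Set.range (fourier (T := (1 : ℝ)))),
      Tendsto (fun i => ∫ x, g x ∂μ i) l (𝓝 (∫ x, g x ∂ν)) := by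
    intro g hg
    induction hg using Submodule.span_induction with
    | mem g hg =>
      obtain ⟨w, rfl⟩ := hg
      simpa [fourierStieltjes] using h (-w)
    | zero => simpa using tendsto_const_nhds
    | add f g _ _ hf hg =>
      simp only [ContinuousMap.add_apply]
      have e : ∀ (m : Measure UnitAddCircle) [IsProbabilityMeasure m],
          ∫ x, f x + g x ∂m = ∫ x, f x ∂m + ∫ x, g x ∂m := fun m _ =>
        integral_add (integrable_of_continuous f.continuous _)
          (integrable_of_continuous g.continuous _)
      simp_rw [e]
      exact hf.add hg
    | smul c f _ hf =>
      simp only [ContinuousMap.smul_apply, integral_smul]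
      exact hf.const_smul c
  have hdist : ∀ (m : Measure UnitAddCircle) [IsProbabilityMeasure m] (g : C(UnitAddCircle, ℂ)),
      dist (∫ x, f x ∂m) (∫ x, g x ∂m) ≤ dist f g := fun m _ g => by
    rw [dist_eq_norm, ← integral_sub (integrable_of_continuous f.continuous _)
      (integrable_of_continuous g.continuous _)]
    refine (norm_integral_le_of_norm_le_const (C := dist f g)
      (Eventually.of_forall fun x => ?_)).trans (by simp)
    rw [← dist_eq_norm]
    exact ContinuousMap.dist_apply_le_dist x
  rw [Metric.tendsto_nhds]
  intro ε hε
  have hf : f ∈ (Submodule.span ℂ (Set.range (fourier (T := (1 : ℝ))))).topologicalClosure := by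
    rw [span_fourier_closure_eq_top]; trivial
  obtain ⟨g, hg, hfg⟩ := Metric.mem_closure_iff.1 hf (ε / 3) (by positivity)
  filter_upwards [Metric.tendsto_nhds.1 (hspan g hg) (ε / 3) (by positivity)] with i hi
  have h1 := hdist (μ i) g
  have h2 := hdist ν g
  rw [dist_comm] at h2
  have h3 := dist_triangle4 (∫ x, f x ∂μ i) (∫ x, g x ∂μ i) (∫ x, g x ∂ν) (∫ x, f x ∂ν)
  linarith

/-- A sparse Riesz product exists, and its Fourier-Stieltjes coefficients are those of the
partial products. -/
theorem exists_rieszProduct (hn : IsSparse n) (ha : ∀ k, |a k| ≤ 1) :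
    ∃ (ν : Measure UnitAddCircle) (_ : IsProbabilityMeasure ν),
      (∀ f : C(UnitAddCircle, ℝ),
        Tendsto (fun N => ∫ x, f x * rieszPartial a n N x ∂haar) atTop (𝓝 (∫ x, f x ∂ν))) ∧
      ∀ N w, |w| ≤ freqSum n N → fourierStieltjes ν w = rieszCoeff a n N w := by
  have hP := isProbabilityMeasure_rieszPartialMeasure hn ha
  set μ : ℕ → ProbabilityMeasure UnitAddCircle := fun N => ⟨rieszPartialMeasure a n N, hP N⟩
  -- Compactness of the space of probabilities gives a limit along a non-principal ultrafilter,
  -- enough to determine all coefficients.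
  obtain ⟨ν, -, hν⟩ := isCompact_univ.ultrafilter_le_nhds ((hyperfilter ℕ).map μ) (by simp)
  have hν' : Tendsto μ (hyperfilter ℕ) (𝓝 ν) := hν
  have hle : ((hyperfilter ℕ : Ultrafilter ℕ) : Filter ℕ) ≤ atTop := Nat.hyperfilter_le_atTop
  rw [ProbabilityMeasure.tendsto_iff_forall_integral_rclike_tendsto ℂ] at hν'
  have hcoeff : ∀ N w, |w| ≤ freqSum n N →
      fourierStieltjes (ν : Measure UnitAddCircle) w = rieszCoeff a n N w := by
    intro N w hw
    have h1 := hν' (BoundedContinuousFunction.mkOfCompact (fourier (-w)))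
    refine tendsto_nhds_unique h1 (Tendsto.congr' ?_ tendsto_const_nhds)
    filter_upwards [hle (eventually_ge_atTop N)] with M hM
    rw [← rieszCoeff_of_le hn hM hw]
    exact (fourierStieltjes_rieszPartialMeasure ha M w).symm
  refine ⟨ν, inferInstance, fun f => ?_, hcoeff⟩
  -- Knowing the coefficients of ν upgrades this to convergence of the whole sequence.
  have h := tendsto_integral_of_tendsto_fourierStieltjes (l := atTop)
    (μ := rieszPartialMeasure a n) (ν := (ν : Measure UnitAddCircle)) (fun w => ?_)
    ((ContinuousMap.mk _ Complex.continuous_ofReal).comp f)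
  · simp only [ContinuousMap.comp_apply, ContinuousMap.coe_mk, integral_complex_ofReal] at h
    have h2 := (Complex.continuous_re.tendsto _).comp h
    refine Tendsto.congr (fun N => ?_) h2
    simp only [Function.comp_apply, Complex.ofReal_re]
    rw [integral_rieszPartialMeasure ha]
    simp_rw [smul_eq_mul, mul_comm]
  · have hw : |w| ≤ freqSum n w.natAbs := by
      rw [Int.abs_eq_natAbs]; exact hn.le_freqSum _
    rw [hcoeff _ w hw]
    refine Tendsto.congr' ?_ tendsto_const_nhds
    filter_upwards [eventually_ge_atTop w.natAbs] with M hM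
    rw [fourierStieltjes_rieszPartialMeasure ha, rieszCoeff_of_le hn hM hw]

/-- If the coefficients tend to zero, the Riesz product is a Rajchman measure. -/
lemma isRajchman_of_tendsto_zero (hn : IsSparse n) (ha : ∀ k, |a k| ≤ 1)
    (ha0 : Tendsto a atTop (𝓝 0)) {ν : Measure UnitAddCircle}
    (hν : ∀ N w, |w| ≤ freqSum n N → fourierStieltjes ν w = rieszCoeff a n N w) :
    IsRajchman ν := by
  rw [IsRajchman, Metric.tendsto_nhds]
  intro ε hε
  obtain ⟨N, hN⟩ := eventually_atTop.1 (Metric.tendsto_nhds.1 ha0 (ε / 2) (by positivity))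
  rw [eventually_cofinite]
  refine (Set.finite_Icc (-freqSum n N) (freqSum n N)).subset fun w hw => ?_
  by_contra hw'
  apply hw
  have hlt : freqSum n N < |w| := by
    by_contra! h; exact hw' (abs_le.1 h)
  rw [hν w.natAbs w (by rw [Int.abs_eq_natAbs]; exact hn.le_freqSum _), dist_zero_right,
    Complex.norm_real, Real.norm_eq_abs]
  refine (abs_rieszCoeff_le hn ha (by positivity) (fun k hk => ?_) hlt _).trans_lt
    (half_lt_self hε)
  have := hN k hk
  rw [dist_zero_right, Real.norm_eq_abs] at this
  exact this.le

end Existence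

/-! ### Convolution operators on the circle -/

section Convolution

variable (ν : Measure UnitAddCircle) [IsProbabilityMeasure ν]

/-- For fixed y the map is a translation. Invariance of `haar`, integrability of y ↦ f(x - y) for
almost every x, and the L¹ contraction all rest on this. -/
lemma measurePreserving_sub_prod :
    MeasurePreserving (fun z : UnitAddCircle × UnitAddCircle => z.1 - z.2) (haar.prod ν) haar := by
  refine ⟨by fun_prop, Measure.ext fun s hs => ?_⟩
  have hm : Measurable fun z : UnitAddCircle × UnitAddCircle => z.1 - z.2 := by fun_prop
  rw [Measure.map_apply hm hs, Measure.prod_apply_symm (hm hs)]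
  have h : ∀ y : UnitAddCircle, haar ((fun x => (x, y)) ⁻¹'
      ((fun z : UnitAddCircle × UnitAddCircle => z.1 - z.2) ⁻¹' s)) = haar s := fun y => by
    have := (measurePreserving_sub_right haar y).measure_preimage hs.nullMeasurableSet
    exact this
  simp [h]

lemma invariant_convKernel : (convKernel ν).Invariant haar := by
  refine Measure.ext fun s hs => ?_
  have hm : Measurable fun z : UnitAddCircle × UnitAddCircle => z.1 - z.2 := by fun_prop
  rw [Measure.bind_apply hs (convKernel ν).measurable.aemeasurable]
  conv_rhs => rw [← (measurePreserving_sub_prod ν).map_eq, Measure.map_apply hm hs,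
    Measure.prod_apply (hm hs)]
  refine lintegral_congr fun x => ?_
  change (ν.map fun y => x - y) s = _
  rw [Measure.map_apply (by fun_prop) hs]
  rfl

lemma fourier_sub_apply (w : ℤ) (x y : UnitAddCircle) :
    (fourier w (x - y) : ℂ) = fourier w x * fourier (-w) y := by
  rw [fourier_apply, fourier_apply, fourier_apply, smul_sub, sub_eq_add_neg, ← neg_smul,
    AddCircle.toCircle_add, Circle.coe_mul]

lemma markovOp_convKernel_sum_fourier (s : Finset ℤ) (c : ℤ → ℂ) (x : UnitAddCircle) :
    markovOp (convKernel ν) (fun y => ∑ w ∈ s, c w * fourier w y) x =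
      ∑ w ∈ s, (fourierStieltjes ν w * c w) * fourier w x := by
  rw [markovOp_convKernel,
    integral_finsetSum _ fun w _ => integrable_of_continuous (by fun_prop) _]
  refine Finset.sum_congr rfl fun w _ => ?_
  simp_rw [fourier_sub_apply]
  rw [integral_const_mul, integral_const_mul, fourierStieltjes]
  ring

variable {ν}

lemma integrable_comp_sub_prod {f : UnitAddCircle → ℂ} (hf : Integrable f haar) :
    Integrable (fun z : UnitAddCircle × UnitAddCircle => f (z.1 - z.2)) (haar.prod ν) :=
  (measurePreserving_sub_prod ν).integrable_comp_of_integrable hf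

lemma aestronglyMeasurable_markovOp_convKernel {f : UnitAddCircle → ℂ} (hf : Integrable f haar) :
    AEStronglyMeasurable (markovOp (convKernel ν) f) haar := by
  have h := (integrable_comp_sub_prod (ν := ν) hf).integral_prod_left.aestronglyMeasurable
  refine h.congr (Eventually.of_forall fun x => ?_)
  exact (markovOp_convKernel ν f x).symm

lemma eLpNorm_one_markovOp_convKernel_le {f : UnitAddCircle → ℂ} (hf : Integrable f haar) :
    eLpNorm (markovOp (convKernel ν) f) 1 haar ≤ eLpNorm f 1 haar := by
  have hm := (integrable_comp_sub_prod (ν := ν) hf).aestronglyMeasurable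
  rw [eLpNorm_one_eq_lintegral_enorm, eLpNorm_one_eq_lintegral_enorm]
  calc ∫⁻ x, ‖markovOp (convKernel ν) f x‖ₑ ∂haar
      ≤ ∫⁻ x, ∫⁻ y, ‖f (x - y)‖ₑ ∂ν ∂haar := by
        refine lintegral_mono fun x => ?_
        rw [markovOp_convKernel]
        exact enorm_integral_le_lintegral_enorm _
    _ = ∫⁻ z, ‖f (z.1 - z.2)‖ₑ ∂(haar.prod ν) := by
        rw [lintegral_prod _ hm.enorm]
    _ = ∫⁻ x, ‖f x‖ₑ ∂haar := by
        have h := (measurePreserving_sub_prod ν).map_eq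
        conv_rhs => rw [← h]
        rw [lintegral_map' (by rw [h]; exact hf.aestronglyMeasurable.enorm) (by fun_prop)]

lemma markovOp_convKernel_sub {f g : UnitAddCircle → ℂ} (hf : Integrable f haar)
    (hg : Integrable g haar) :
    markovOp (convKernel ν) f - markovOp (convKernel ν) g =ᵐ[haar]
      markovOp (convKernel ν) (f - g) := by
  filter_upwards [(integrable_comp_sub_prod (ν := ν) hf).prod_right_ae,
    (integrable_comp_sub_prod (ν := ν) hg).prod_right_ae] with x h1 h2
  simp only [Pi.sub_apply, markovOp_convKernel]
  rw [integral_sub h1 h2]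

end Convolution

/-! ### Hyperboundedness -/

lemma eLpNorm_natCast_le_of_integral_le {X : Type*} [TopologicalSpace X] [CompactSpace X]
    [MeasurableSpace X] [OpensMeasurableSpace X] (μ : Measure X) [IsFiniteMeasure μ]
    {f : X → ℂ} (hf : Continuous f) {k : ℕ} (hk : k ≠ 0) {C : ℝ} (hC : 0 ≤ C)
    (h : ∫ x, ‖f x‖ ^ k ∂μ ≤ C ^ k) : eLpNorm f k μ ≤ ENNReal.ofReal C := by
  have hk' : (k : ℝ≥0∞) ≠ 0 := by exact_mod_cast hk
  rw [eLpNorm_eq_lintegral_rpow_enorm_toReal hk' (by simp)]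
  simp only [ENNReal.toReal_natCast, ENNReal.rpow_natCast]
  have e : ∫⁻ x, ‖f x‖ₑ ^ k ∂μ = ENNReal.ofReal (∫ x, ‖f x‖ ^ k ∂μ) := by
    rw [ofReal_integral_eq_lintegral_ofReal
      (integrable_of_continuous (by fun_prop) _) (Eventually.of_forall fun x => by positivity)]
    refine lintegral_congr fun x => ?_
    rw [ENNReal.ofReal_pow (norm_nonneg _), ofReal_norm]
  rw [e]
  calc ENNReal.ofReal (∫ x, ‖f x‖ ^ k ∂μ) ^ (1 / (k : ℝ))
      ≤ ENNReal.ofReal (C ^ k) ^ (1 / (k : ℝ)) := by gcongr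
    _ = ENNReal.ofReal C := by
        rw [ENNReal.ofReal_pow hC, one_div, ENNReal.pow_rpow_inv_natCast hk]

lemma tendsto_Icc_freqSum {n : ℕ → ℕ} (hn : IsSparse n) :
    Tendsto (fun N => Finset.Icc (-freqSum n N) (freqSum n N)) atTop atTop := by
  refine tendsto_atTop_finset_of_monotone (fun M N h => ?_) fun w => ⟨w.natAbs, ?_⟩
  · have := freqSum_mono n h
    exact Finset.Icc_subset_Icc (by omega) this
  · have := hn.le_freqSum w.natAbs
    rw [Finset.mem_Icc]
    omega

/-- The partial sums of the Fourier series converge in `L²`. -/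
lemma tendsto_eLpNorm_sub_sum_fourier {n : ℕ → ℕ} (hn : IsSparse n) {f : UnitAddCircle → ℂ}
    (hf : MemLp f 2 haar) :
    Tendsto (fun N => eLpNorm ((fun x => ∑ w ∈ Finset.Icc (-freqSum n N) (freqSum n N),
      fourierCoeff f w * fourier w x) - f) 2 haar) atTop (𝓝 0) := by
  have h := (hasSum_fourier_series_L2 (hf.toLp f)).comp (tendsto_Icc_freqSum hn)
  have h2 := (Lp.tendsto_Lp_iff_tendsto_eLpNorm' _ _).1 h
  refine Tendsto.congr (fun N => eLpNorm_congr_ae ?_) h2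
  have hc : ∀ w, fourierCoeff (hf.toLp f) w = fourierCoeff f w := fun w =>
    congrFun (fourierCoeff_congr_ae hf.coeFn_toLp) w
  refine EventuallyEq.sub ?_ hf.coeFn_toLp
  simp only [Function.comp_apply, hc, fourierLp]
  simp_rw [← map_smul]
  rw [← map_sum]
  refine (ContinuousMap.coeFn_toLp haar _).trans (Eventually.of_forall fun x => ?_)
  simp

lemma sum_norm_sq_fourierCoeff_le {f : UnitAddCircle → ℂ} (hf : MemLp f 2 haar) (s : Finset ℤ) :
    ∑ w ∈ s, ‖fourierCoeff f w‖ ^ 2 ≤ (eLpNorm f 2 haar).toReal ^ 2 := by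
  have h := hasSum_sq_fourierCoeff (hf.toLp f)
  have hc : ∀ w, fourierCoeff (hf.toLp f) w = fourierCoeff f w := fun w =>
    congrFun (fourierCoeff_congr_ae hf.coeFn_toLp) w
  simp only [hc] at h
  refine (sum_le_hasSum s (fun _ _ => by positivity) h).trans_eq ?_
  rw [hf.eLpNorm_eq_integral_rpow_norm (by simp) (by simp),
    ENNReal.toReal_ofReal (by positivity), ← Real.rpow_natCast, ← Real.rpow_mul (by positivity)]
  norm_num
  refine integral_congr_ae ?_
  filter_upwards [hf.coeFn_toLp] with x hx
  rw [hx]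

/-- Convolution with a sparse Riesz product is a contraction from `L²` to `L⁴`. -/
theorem eLpNorm_four_markovOp_le {a : ℕ → ℝ} {n : ℕ → ℕ} (hn : IsSparse n)
    (ha : ∀ k, |a k| ≤ 1) {ν : Measure UnitAddCircle} [IsProbabilityMeasure ν]
    (hν : ∀ N w, |w| ≤ freqSum n N → fourierStieltjes ν w = rieszCoeff a n N w)
    {f : UnitAddCircle → ℂ} (hf : MemLp f 2 haar) :
    eLpNorm (markovOp (convKernel ν) f) 4 haar ≤ eLpNorm f 2 haar := by
  set c : ℤ → ℂ := fourierCoeff f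
  set F : ℕ → UnitAddCircle → ℂ := fun N x =>
    ∑ w ∈ Finset.Icc (-freqSum n N) (freqSum n N), c w * fourier w x with hF
  have hfi : Integrable f haar := hf.integrable (by norm_num)
  have hFi : ∀ N, Integrable (F N) haar := fun N => integrable_of_continuous (by fun_prop) _
  have hPF : ∀ N, markovOp (convKernel ν) (F N) = rieszTransform a n N c := fun N => by
    ext x
    rw [hF, markovOp_convKernel_sum_fourier, rieszTransform]
    simp only [ContinuousMap.sum_apply, ContinuousMap.smul_apply, smul_eq_mul]
    refine Finset.sum_congr rfl fun w hw => ?_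
    rw [hν N w (abs_le.2 (Finset.mem_Icc.1 hw))]
  have hbound : ∀ N, eLpNorm (markovOp (convKernel ν) (F N)) 4 haar ≤ eLpNorm f 2 haar := by
    intro N
    rw [hPF, ← ENNReal.ofReal_toReal hf.eLpNorm_ne_top]
    refine eLpNorm_natCast_le_of_integral_le haar (k := 4) (rieszTransform a n N c).continuous
      (by norm_num) ENNReal.toReal_nonneg ?_
    refine (integral_norm_rieszTransform_pow_four_le hn ha N c).trans ?_
    rw [show 4 = 2 * 2 from rfl, pow_mul]
    gcongr
    exact sum_norm_sq_fourierCoeff_le hf _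
  -- The L⁴ bound is so far known only for trigonometric polynomials; L¹ continuity is enough to
  -- identify the limit.
  have hlim : Tendsto (fun N => eLpNorm (markovOp (convKernel ν) (F N) -
      markovOp (convKernel ν) f) 1 haar) atTop (𝓝 0) := by
    refine tendsto_of_tendsto_of_tendsto_of_le_of_le tendsto_const_nhds
      (tendsto_eLpNorm_sub_sum_fourier hn hf) (fun _ => zero_le) fun N => ?_
    calc eLpNorm (markovOp (convKernel ν) (F N) - markovOp (convKernel ν) f) 1 haar
        = eLpNorm (markovOp (convKernel ν) (F N - f)) 1 haar :=
          eLpNorm_congr_ae (markovOp_convKernel_sub (hFi N) hfi)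
      _ ≤ eLpNorm (F N - f) 1 haar := eLpNorm_one_markovOp_convKernel_le ((hFi N).sub hfi)
      _ ≤ eLpNorm (F N - f) 2 haar := eLpNorm_le_eLpNorm_of_exponent_le (by norm_num)
          ((hFi N).sub hfi).aestronglyMeasurable
  obtain ⟨ns, -, hns⟩ := (tendstoInMeasure_of_tendsto_eLpNorm one_ne_zero
    (fun N => aestronglyMeasurable_markovOp_convKernel (hFi N))
    (aestronglyMeasurable_markovOp_convKernel hfi) hlim).exists_seq_tendsto_ae
  -- Fatou's lemma carries the uniform L⁴ bound to the almost everywhere limit.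
  refine (Lp.eLpNorm_lim_le_liminf_eLpNorm
    (fun i => aestronglyMeasurable_markovOp_convKernel (hFi (ns i))) _ hns).trans ?_
  exact liminf_le_of_frequently_le' (Frequently.of_forall fun i => hbound (ns i))

theorem isHyperbounded_rieszProduct {a : ℕ → ℝ} {n : ℕ → ℕ} (hn : IsSparse n)
    (ha : ∀ k, |a k| ≤ 1) {ν : Measure UnitAddCircle} [IsProbabilityMeasure ν]
    (hν : ∀ N w, |w| ≤ freqSum n N → fourierStieltjes ν w = rieszCoeff a n N w) :
    IsHyperbounded haar (convKernel ν) := by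
  refine ⟨invariant_convKernel ν, 2, 4, by norm_num, by norm_num, 1, fun f hf => ?_⟩
  have h := eLpNorm_four_markovOp_le hn ha hν hf
  exact ⟨⟨aestronglyMeasurable_markovOp_convKernel (hf.integrable (by norm_num)),
    h.trans_lt hf.eLpNorm_lt_top⟩, by simpa using h⟩

/-! ### Singularity of the convolution powers -/

lemma fourierStieltjes_neg (ρ : Measure UnitAddCircle) (w : ℤ) :
    fourierStieltjes ρ (-w) = star (fourierStieltjes ρ w) := by
  rw [fourierStieltjes, fourierStieltjes, Complex.star_def, ← integral_conj]
  simp_rw [← fourier_neg]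

instance isProbabilityMeasure_convPow (ν : Measure UnitAddCircle) [IsProbabilityMeasure ν]
    (m : ℕ) : IsProbabilityMeasure (convPow ν m) := by
  induction m with
  | zero => rw [convPow]; infer_instance
  | succ m ih => rw [convPow]; infer_instance

lemma fourierStieltjes_convPow (ν : Measure UnitAddCircle) [IsProbabilityMeasure ν]
    (m : ℕ) (w : ℤ) : fourierStieltjes (convPow ν m) w = fourierStieltjes ν w ^ m := by
  induction m with
  | zero => simp [convPow, fourierStieltjes]
  | succ m ih =>
    have h : ∀ x y : UnitAddCircle, (fourier (-w) (x + y) : ℂ) =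
        fourier (-w) x * fourier (-w) y := fun x y => by
      rw [← sub_neg_eq_add, fourier_sub_apply]
      congr 1
      simp [fourier_apply]
    rw [pow_succ, ← ih, convPow, fourierStieltjes,
      integral_conv (integrable_of_continuous (fourier (-w)).continuous _)]
    simp_rw [h, integral_const_mul, integral_mul_const]
    rfl

/-- If the centred characters `e_{m k} - s k` are orthogonal in `L²(ρ)`, then their weighted sums
have small norm. -/
lemma integral_norm_sq_sum_sub_le {ρ : Measure UnitAddCircle} [IsProbabilityMeasure ρ]
    {s : ℕ → ℝ} {m : ℕ → ℤ} (h1 : ∀ k, fourierStieltjes ρ (m k) = s k)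
    (h2 : ∀ j k, j < k → fourierStieltjes ρ (m k - m j) = s k * s j) (r : ℕ → ℝ) (N : ℕ) :
    ∫ x, ‖∑ k ∈ Finset.range N, (r k : ℂ) * (fourier (m k) x - s k)‖ ^ 2 ∂ρ ≤
      ∑ k ∈ Finset.range N, r k ^ 2 := by
  have e1 : ∀ k, ∫ x, fourier (m k) x ∂ρ = s k := fun k => by
    have := fourierStieltjes_neg ρ (m k)
    rw [h1] at this
    simpa [fourierStieltjes] using this
  have e1' : ∀ k, ∫ x, fourier (-m k) x ∂ρ = s k := h1
  have e2 : ∀ j k, j ≠ k → ∫ x, fourier (m k - m j) x ∂ρ = s k * s j := by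
    intro j k hjk
    rcases lt_or_gt_of_ne hjk with h | h
    · have := fourierStieltjes_neg ρ (m k - m j)
      rw [h2 j k h] at this
      simpa [fourierStieltjes] using this
    · have := h2 k j h
      rw [fourierStieltjes, neg_sub] at this
      rw [this, mul_comm]
  -- Expanding, the off-diagonal entry is ρ̂(m_k - m_j) - s_k s_j up to conjugation, which `h2`
  -- makes zero.
  have key : ∀ j k, ∫ x, (fourier (m k) x - s k) * star (fourier (m j) x - (s j : ℂ)) ∂ρ =
      if j = k then (1 - s k ^ 2 : ℂ) else 0 := by
    intro j k
    have hx : ∀ x : UnitAddCircle, (fourier (m k) x - s k) * star (fourier (m j) x - (s j : ℂ)) =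
        fourier (m k - m j) x - s j * fourier (m k) x - s k * fourier (-m j) x + s k * s j :=
      fun x => by
        rw [sub_eq_add_neg (m k), fourier_add, fourier_neg, star_sub]
        simp only [Complex.star_def, Complex.conj_ofReal]
        ring
    simp_rw [hx]
    rw [integral_add (integrable_of_continuous (by fun_prop) _)
        (integrable_of_continuous (by fun_prop) _),
      integral_sub (integrable_of_continuous (by fun_prop) _)
        (integrable_of_continuous (by fun_prop) _),
      integral_sub (integrable_of_continuous (by fun_prop) _)
        (integrable_of_continuous (by fun_prop) _),
      integral_const_mul, integral_const_mul, e1, e1']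
    split_ifs with h
    · subst h
      simp
      ring
    · rw [e2 j k h]
      simp
      ring
  have hval : ∫ x, ‖∑ k ∈ Finset.range N, (r k : ℂ) * (fourier (m k) x - s k)‖ ^ 2 ∂ρ =
      ∑ k ∈ Finset.range N, r k ^ 2 * (1 - s k ^ 2) := by
    apply Complex.ofReal_injective
    rw [← integral_complex_ofReal]
    have hx : ∀ x : UnitAddCircle,
        ((‖∑ k ∈ Finset.range N, (r k : ℂ) * (fourier (m k) x - s k)‖ ^ 2 : ℝ) : ℂ) =
        ∑ k ∈ Finset.range N, ∑ j ∈ Finset.range N, ((r k : ℂ) * r j) *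
          ((fourier (m k) x - s k) * star (fourier (m j) x - (s j : ℂ))) := fun x => by
      rw [ofReal_norm_sq, star_sum, Finset.sum_mul_sum]
      refine Finset.sum_congr rfl fun i _ => Finset.sum_congr rfl fun j _ => ?_
      rw [star_mul']
      simp only [Complex.star_def, Complex.conj_ofReal]
      ring
    simp_rw [hx]
    rw [integral_finsetSum _ fun i _ => integrable_of_continuous (by fun_prop) _,
      Complex.ofReal_sum]
    refine Finset.sum_congr rfl fun k hk => ?_
    rw [integral_finsetSum _ fun i _ => integrable_of_continuous (by fun_prop) _]
    simp_rw [integral_const_mul, key]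
    simp only [mul_ite, mul_zero, Finset.sum_ite_eq', hk, if_true]
    push_cast
    ring
  rw [hval]
  refine Finset.sum_le_sum fun k _ => ?_
  nlinarith [mul_nonneg (sq_nonneg (r k)) (sq_nonneg (s k))]

/-- The L² norm of the average is at most (∑ r_k²)^(-1/2). The weights `r` are kept separate from
the means `s` so that the same weights serve ρ, with s = r, and Haar measure, with s = 0. -/
lemma tendstoInMeasure_weighted_average {ρ : Measure UnitAddCircle} [IsProbabilityMeasure ρ]
    {s : ℕ → ℝ} {m : ℕ → ℤ} (h1 : ∀ k, fourierStieltjes ρ (m k) = s k)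
    (h2 : ∀ j k, j < k → fourierStieltjes ρ (m k - m j) = s k * s j) {r : ℕ → ℝ}
    (hr : Tendsto (fun N => ∑ k ∈ Finset.range N, r k ^ 2) atTop atTop) :
    TendstoInMeasure ρ (fun N x => ((∑ k ∈ Finset.range N, r k ^ 2 : ℝ) : ℂ)⁻¹ *
      ∑ k ∈ Finset.range N, (r k : ℂ) * (fourier (m k) x - s k)) atTop fun _ => 0 := by
  refine tendstoInMeasure_of_tendsto_eLpNorm (p := 2) (by norm_num)
    (fun N => Continuous.aestronglyMeasurable (by fun_prop)) aestronglyMeasurable_const ?_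
  have hlim : Tendsto (fun N => ENNReal.ofReal (√(∑ k ∈ Finset.range N, r k ^ 2))⁻¹) atTop
      (𝓝 0) := by
    rw [← ENNReal.ofReal_zero]
    exact ENNReal.tendsto_ofReal (tendsto_inv_atTop_zero.comp (Real.tendsto_sqrt_atTop.comp hr))
  refine tendsto_of_tendsto_of_tendsto_of_le_of_le tendsto_const_nhds hlim
    (fun _ => zero_le) fun N => ?_
  set σ := ∑ k ∈ Finset.range N, r k ^ 2 with hσ
  have hσ0 : 0 ≤ σ := Finset.sum_nonneg fun _ _ => sq_nonneg _
  refine eLpNorm_natCast_le_of_integral_le ρ (k := 2) (by fun_prop) (by norm_num)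
    (by positivity) ?_
  simp only [Pi.sub_apply, sub_zero, norm_mul, mul_pow, norm_inv, Complex.norm_real,
    Real.norm_eq_abs, abs_of_nonneg hσ0]
  rw [integral_const_mul, inv_pow, inv_pow, Real.sq_sqrt hσ0]
  calc (σ ^ 2)⁻¹ * _ ≤ (σ ^ 2)⁻¹ * σ := by
        gcongr; exact integral_norm_sq_sum_sub_le h1 h2 r N
    _ ≤ σ⁻¹ := by
        -- While the sum of squares is still 0, both sides vanish because the inverse of 0 is 0.
        rcases hσ0.eq_or_lt with h | h
        · simp [← h]
        · apply le_of_eq; field_simp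

/-- A probability on the circle for which the centred characters `e_{m k} - r k` are orthogonal is
singular as soon as `∑ r k ^ 2` diverges. -/
theorem mutuallySingular_haar_of_tendsto_atTop {ρ : Measure UnitAddCircle}
    [IsProbabilityMeasure ρ] {r : ℕ → ℝ} {m : ℕ → ℤ} (hm : StrictMono m) (hm0 : ∀ k, m k ≠ 0)
    (h1 : ∀ k, fourierStieltjes ρ (m k) = r k)
    (h2 : ∀ j k, j < k → fourierStieltjes ρ (m k - m j) = r k * r j)
    (hr : Tendsto (fun N => ∑ k ∈ Finset.range N, r k ^ 2) atTop atTop) :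
    ρ.MutuallySingular haar := by
  have hh : ∀ w : ℤ, w ≠ 0 → fourierStieltjes haar w = 0 := fun w hw => by
    rw [fourierStieltjes, integral_fourier, if_neg (neg_ne_zero.2 hw)]
  have H1 := tendstoInMeasure_weighted_average (ρ := haar) (s := 0) (m := m)
    (fun k => by simp [hh _ (hm0 k)])
    (fun j k hjk => by simp [hh _ (sub_ne_zero.2 (hm hjk).ne')]) hr
  have H2 := tendstoInMeasure_weighted_average h1 h2 hr
  obtain ⟨u, hu, H1'⟩ := H1.exists_seq_tendsto_ae
  -- Extracted from the first subsequence, so both averages converge along `u ∘ v`. No point can lie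
  -- in both convergence sets, since there the constant 1 would tend to 0.
  obtain ⟨v, hv, H2'⟩ := (H2.comp hu.tendsto_atTop).exists_seq_tendsto_ae
  refine Measure.MutuallySingular.mk (ae_iff.1 H2') (ae_iff.1 H1') fun x _ => ?_
  by_contra hx
  simp only [Set.mem_union, Set.mem_ofPred_eq, not_or, not_not] at hx
  obtain ⟨hx2, hx1⟩ := hx
  have hx1' := hx1.comp hv.tendsto_atTop
  have hone : Tendsto (fun _ : ℕ => (1 : ℂ)) atTop (𝓝 0) := by
    have := hx1'.sub hx2
    rw [sub_zero] at this
    refine this.congr' ?_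
    filter_upwards [((hr.comp hu.tendsto_atTop).comp hv.tendsto_atTop).eventually_gt_atTop 0]
      with i hi
    simp only [Function.comp_apply] at hi ⊢
    rw [← mul_sub, ← Finset.sum_sub_distrib]
    have e : ∀ k, (r k : ℂ) * (fourier (m k) x - ((0 : ℕ → ℝ) k : ℝ)) -
        (r k : ℂ) * (fourier (m k) x - r k) = ((r k ^ 2 : ℝ) : ℂ) := fun k => by
      push_cast [Pi.zero_apply]; ring
    simp_rw [e]
    rw [← Complex.ofReal_sum, inv_mul_cancel₀]
    exact_mod_cast hi.ne'
  exact one_ne_zero (tendsto_nhds_unique tendsto_const_nhds hone)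

/-- Convolution powers raise coefficients to the m-th power, which preserves the product formula for
ν̂(n_k - n_j). -/
theorem mutuallySingular_convPow {a : ℕ → ℝ} {n : ℕ → ℕ} (hn : IsSparse n)
    {ν : Measure UnitAddCircle} [IsProbabilityMeasure ν]
    (hν : ∀ N w, |w| ≤ freqSum n N → fourierStieltjes ν w = rieszCoeff a n N w) {m : ℕ}
    (hdiv : Tendsto (fun N => ∑ k ∈ Finset.range N, ((a k / 2) ^ m) ^ 2) atTop atTop) :
    (convPow ν m).MutuallySingular haar := by
  have hlt : ∀ {j k : ℕ}, j < k → (n j : ℤ) < n k := fun {j k} h => by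
    have h0 := le_freqSum_of_lt n h
    have h1 := hn k
    have := freqSum_nonneg n k
    omega
  have hle : ∀ k, (n k : ℤ) ≤ freqSum n (k + 1) := fun k => le_freqSum_of_lt n (Nat.lt_succ_self k)
  refine mutuallySingular_haar_of_tendsto_atTop (m := fun k => (n k : ℤ)) (fun _ _ h => hlt h)
    (fun k => (hn.pos k).ne') (fun k => ?_) (fun j k hjk => ?_) hdiv
  · rw [fourierStieltjes_convPow, hν (k + 1) _ (by rw [Nat.abs_cast]; exact hle k),
      rieszCoeff_freq hn]
    push_cast
    rfl
  · have := hlt hjk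
    have := hle k
    rw [fourierStieltjes_convPow, hν (k + 1) _ (by rw [abs_le]; omega),
      rieszCoeff_freq_sub hn hjk]
    push_cast
    rw [mul_pow]

/-! ### Failure of Harris recurrence -/

lemma convKernel_pow_apply (ν : Measure UnitAddCircle) [IsProbabilityMeasure ν] (m : ℕ)
    (x : UnitAddCircle) : (convKernel ν ^ m) x = (convPow ν m).map fun y => x - y := by
  induction m generalizing x with
  | zero =>
    rw [pow_zero, convPow, Measure.map_dirac' (by fun_prop), sub_zero]
    exact Kernel.id_apply x
  | succ m ih =>
    refine Measure.ext fun s hs => ?_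
    have hsub : ∀ z : UnitAddCircle, Measurable fun y => z - y := fun z => by fun_prop
    rw [Kernel.pow_add_apply_eq_lintegral _ m 1 x hs, ih, pow_one,
      lintegral_map ((convKernel ν).measurable_coe hs) (hsub x),
      Measure.map_apply (hsub x) hs, convPow, ← lintegral_indicator_one ((hsub x) hs),
      Measure.lintegral_conv (measurable_one.indicator ((hsub x) hs))]
    refine lintegral_congr fun y => ?_
    change (ν.map fun t => (x - y) - t) s = _
    rw [Measure.map_apply (hsub _) hs, ← lintegral_indicator_one ((hsub _) hs)]
    refine lintegral_congr fun t => ?_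
    change s.indicator 1 (x - y - t) = s.indicator 1 (x - (y + t))
    rw [sub_sub]

lemma mutuallySingular_map_sub_left {ρ : Measure UnitAddCircle} (h : ρ.MutuallySingular haar)
    (x : UnitAddCircle) : (ρ.map fun y => x - y).MutuallySingular haar := by
  obtain ⟨s, hs, h1, h2⟩ := h
  have hm : Measurable fun y : UnitAddCircle => x - y := by fun_prop
  refine ⟨(fun y => x - y) ⁻¹' s, hm hs, ?_, ?_⟩
  · rw [Measure.map_apply hm (hm hs), ← Set.preimage_comp]
    simpa [Function.comp_def] using h1
  · rw [← Set.preimage_compl]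
    exact ((Measure.measurePreserving_sub_left haar x).measure_preimage
      hs.compl.nullMeasurableSet).trans h2

/-- If, for each measurable set `A`, `κ x A ≤ Q x A` holds for almost every `x`, then
`κ x ≤ Q x` for almost every `x`. -/
lemma ae_le_of_forall_ae_le {S : Type*} [TopologicalSpace S] [SecondCountableTopology S]
    [MeasurableSpace S] [OpensMeasurableSpace S] {μ : Measure S} {κ Q : S → Measure S}
    [∀ x, (Q x).OuterRegular]
    (h : ∀ A, MeasurableSet A → ∀ᵐ x ∂μ, κ x A ≤ Q x A) : ∀ᵐ x ∂μ, κ x ≤ Q x := by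
  set B := TopologicalSpace.countableBasis S
  have hB := TopologicalSpace.isBasis_countableBasis S
  -- Countably many test sets permit the exchange of quantifiers. Finite unions of basic sets are
  -- needed because they increase to any open set; outer regularity of `Q x` then reaches all sets.
  have hcount : {t : Set (Set S) | t.Finite ∧ t ⊆ B}.Countable :=
    Set.countable_ofPred_finite_subset (TopologicalSpace.countable_countableBasis S)
  have hae : ∀ᵐ x ∂μ, ∀ t ∈ {t : Set (Set S) | t.Finite ∧ t ⊆ B}, κ x (⋃₀ t) ≤ Q x (⋃₀ t) := by
    rw [ae_ball_iff hcount]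
    rintro t ⟨-, htB⟩
    exact h _ (isOpen_sUnion fun s hs => hB.isOpen (htB hs)).measurableSet
  filter_upwards [hae] with x hx
  have hopen : ∀ U, IsOpen U → κ x U ≤ Q x U := by
    intro U hU
    obtain ⟨t, htB, rfl⟩ := hB.open_eq_sUnion hU
    have htc : t.Countable := (TopologicalSpace.countable_countableBasis S).mono htB
    rcases t.eq_empty_or_nonempty with rfl | hne
    · simp
    obtain ⟨f, rfl⟩ := htc.exists_eq_range hne
    rw [Set.sUnion_range, measure_iUnion_eq_iSup_accumulate, measure_iUnion_eq_iSup_accumulate]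
    refine iSup_mono fun N => ?_
    have he : Set.accumulate f N = ⋃₀ (f '' Set.Iic N) := by
      rw [Set.sUnion_image]; rfl
    rw [he]
    exact hx _ ⟨(Set.finite_Iic N).image f, (Set.image_subset_range f _).trans htB⟩
  refine Measure.le_iff.2 fun s _ => ?_
  rw [Set.measure_eq_iInf_isOpen s (Q x)]
  exact le_iInf₂ fun U hsU => le_iInf fun hU => (measure_mono hsU).trans (hopen U hU)

/-- For almost every x, the measure with density k(x, ·) is absolutely continuous and lies below a
reflected translate of ν^m, which is singular. It is therefore zero. -/
theorem not_isHarrisRecurrent_convKernel {ν : Measure UnitAddCircle} [IsProbabilityMeasure ν]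
    (h : ∀ m, 1 ≤ m → (convPow ν m).MutuallySingular haar) :
    ¬ IsHarrisRecurrent haar (convKernel ν) := by
  rintro ⟨-, m, hm, k, hk, hk0, hle⟩
  have hkx : ∀ x, Measurable (k x) := fun x => hk.of_uncurry_left
  have hQ : ∀ x, ((convKernel ν ^ m) x).OuterRegular := fun x => by
    rw [convKernel_pow_apply]
    have : IsProbabilityMeasure ((convPow ν m).map fun y => x - y) :=
      Measure.isProbabilityMeasure_map (by fun_prop)
    infer_instance
  have hae : ∀ᵐ x ∂haar, haar.withDensity (k x) ≤ (convKernel ν ^ m) x :=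
    ae_le_of_forall_ae_le fun A hA => by
      simpa only [withDensity_apply _ hA] using hle A hA
  refine hk0 (lintegral_eq_zero_of_ae_eq_zero ?_)
  filter_upwards [hae] with x hx
  rw [convKernel_pow_apply] at hx
  have hs := (mutuallySingular_map_sub_left (h m hm) x).mono_ac hx.absolutelyContinuous
    Measure.AbsolutelyContinuous.rfl
  have h0 := Measure.eq_zero_of_absolutelyContinuous_of_mutuallySingular
    (withDensity_absolutelyContinuous haar (k x)) hs
  have := congrArg (fun ρ : Measure UnitAddCircle => ρ Set.univ) h0
  simpa [withDensity_apply _ MeasurableSet.univ] using this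

/-! ### The example -/

/-- The coefficients of the example: they tend to zero more slowly than every power. -/
def slowCoeff (k : ℕ) : ℝ := (1 + Real.log (k + 1))⁻¹

lemma one_le_one_add_log (k : ℕ) : 1 ≤ 1 + Real.log (k + 1) := by
  have : 0 ≤ Real.log (k + 1) := Real.log_nonneg (by linarith [(Nat.cast_nonneg k : (0 : ℝ) ≤ k)])
  linarith

lemma slowCoeff_pos (k : ℕ) : 0 < slowCoeff k :=
  inv_pos.2 (one_pos.trans_le (one_le_one_add_log k))

lemma abs_slowCoeff_le_one (k : ℕ) : |slowCoeff k| ≤ 1 := by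
  rw [abs_of_pos (slowCoeff_pos k)]
  exact inv_le_one_of_one_le₀ (one_le_one_add_log k)

lemma tendsto_natCast_add_one : Tendsto (fun k : ℕ => (k : ℝ) + 1) atTop atTop :=
  tendsto_atTop_add_const_right _ _ tendsto_natCast_atTop_atTop

lemma tendsto_slowCoeff : Tendsto slowCoeff atTop (𝓝 0) :=
  tendsto_inv_atTop_zero.comp (tendsto_atTop_add_const_left _ _
    (Real.tendsto_log_atTop.comp tendsto_natCast_add_one))

/-- Powers of the logarithm are o(k), so the terms eventually dominate those of the harmonic series.
-/
lemma tendsto_sum_slowCoeff (m : ℕ) :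
    Tendsto (fun N => ∑ k ∈ Finset.range N, ((slowCoeff k / 2) ^ m) ^ 2) atTop atTop := by
  rw [← not_summable_iff_tendsto_nat_atTop_of_nonneg fun k => by positivity]
  intro hs
  have hlog : (fun x : ℝ => (2 * (1 + Real.log x)) ^ (m * 2)) =o[atTop] (fun x : ℝ => x) := by
    have hO : (fun x : ℝ => 2 * (1 + Real.log x)) =O[atTop] Real.log := by
      refine Asymptotics.IsBigO.of_bound 4 ?_
      filter_upwards [Real.tendsto_log_atTop.eventually_ge_atTop 1] with x hx
      rw [Real.norm_of_nonneg (by linarith), Real.norm_of_nonneg (by linarith)]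
      linarith
    exact (hO.pow _).trans_isLittleO Real.isLittleO_pow_log_id_atTop
  have hlog' := (hlog.comp_tendsto tendsto_natCast_add_one).bound one_pos
  have : Summable fun k : ℕ => ((k : ℝ) + 1)⁻¹ := by
    refine summable_of_isBigO_nat hs ?_
    refine Asymptotics.IsBigO.of_bound 1 ?_
    filter_upwards [hlog'] with k hk
    have hpos := slowCoeff_pos k
    have h1 := one_le_one_add_log k
    simp only [Function.comp_apply, Real.norm_eq_abs, one_mul] at hk ⊢
    have h2 : (0 : ℝ) < k + 1 := by positivity
    rw [abs_of_pos (by positivity), abs_of_pos (by positivity)]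
    rw [abs_of_pos (by positivity), abs_of_pos h2] at hk
    rw [← pow_mul, slowCoeff, div_eq_mul_inv, ← mul_inv, inv_pow, mul_comm _ (2 : ℝ)]
    gcongr
  exact Real.not_summable_natCast_inv ((summable_nat_add_iff 1).1 (by simpa using this))

/-- The geometric sum is (6^N - 1)/5, and 4/5 < 1; any integer ratio of at least 5 would do. -/
lemma isSparse_pow_six : IsSparse fun k => 6 ^ k := by
  have h : ∀ N, 5 * freqSum (fun k => 6 ^ k) N = 6 ^ N - 1 := fun N => by
    induction N with
    | zero => simp [freqSum]
    | succ N ih => rw [freqSum_succ, mul_add, ih]; push_cast; ring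
  intro N
  have h1 := h N
  have h2 := freqSum_nonneg (fun k => 6 ^ k) N
  push_cast
  omega

end HyperboundedMarkov

end

open HyperboundedMarkov in
theorem theorem6 :
    ∃ (ν : MeasureTheory.Measure UnitAddCircle) (_ : MeasureTheory.IsProbabilityMeasure ν),
      (∃ (a : ℕ → ℝ) (n : ℕ → ℕ), HyperboundedMarkov.IsRieszProduct ν a n) ∧
      HyperboundedMarkov.IsRajchman ν ∧
      MeasureTheory.Measure.MutuallySingular ν HyperboundedMarkov.haar ∧
      (∀ m : ℕ, 1 ≤ m →
        MeasureTheory.Measure.MutuallySingular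
          (HyperboundedMarkov.convPow ν m) HyperboundedMarkov.haar) ∧
      ¬ HyperboundedMarkov.IsHarrisRecurrent HyperboundedMarkov.haar
          (HyperboundedMarkov.convKernel ν) ∧
      HyperboundedMarkov.IsHyperbounded HyperboundedMarkov.haar
          (HyperboundedMarkov.convKernel ν) := by
  obtain ⟨ν, hP, hweak, hcoeff⟩ := exists_rieszProduct isSparse_pow_six abs_slowCoeff_le_one
  have hsing : ∀ m : ℕ, (convPow ν m).MutuallySingular haar := fun m =>
    mutuallySingular_convPow isSparse_pow_six hcoeff (tendsto_sum_slowCoeff m)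
  refine ⟨ν, hP, ⟨slowCoeff, fun k => 6 ^ k, fun k => ⟨(slowCoeff_pos k).ne',
    abs_slowCoeff_le_one k⟩, fun k => by positivity, ⟨6, by norm_num, fun k => ?_⟩, hweak⟩,
    isRajchman_of_tendsto_zero isSparse_pow_six abs_slowCoeff_le_one tendsto_slowCoeff hcoeff,
    ?_, fun m _ => hsing m, not_isHarrisRecurrent_convKernel fun m _ => hsing m,
    isHyperbounded_rieszProduct isSparse_pow_six abs_slowCoeff_le_one hcoeff⟩
  · push_cast
    rw [pow_succ, mul_comm]
  -- The recursion starts at the Dirac mass, so the first power is δ_0 * ν = ν.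
  · have h := hsing 1
    rwa [convPow, convPow, Measure.dirac_zero_conv] at h
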